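/- A graph $G=(X,b)$ consists of a nonempty countable set $X$ and a symmetric function $b\colon X\times X\to[0,\infty)$ with $b(x,x)=0$ and $\deg(x):=\sum_{y\in X}b(x,y)<\infty$ for all $x\in X$; it is connected if any $x,y\in X$ are joined by a finite sequence of vertices $x=x_1,\dots,x_n=y$ with $b(x_i,x_{i+1})>0$. For $f\colon X\to\mathbb R$ let $$Q(f)=\tfrac12\sum_{x,y\in X}b(x,y)|f(x)-f(y)|^2\in[0,\infty],\qquad \mathfrak D(G)=\{f\colon X\to\mathbb R\mid Q(f)<\infty\},$$ and let $\mathfrak H(G)$ be the space of harmonic functions, i.e. of all $f\colon X\to\mathbb R$ with $f(x)=\frac1{\deg(x)}\sum_{y\in X}b(x,y)f(y)$ for all $x\in X$, where the sums converge absolutely. Let $m\colon X\to(0,\infty)$ be a finite measure, i.e. $\sum_{x\in X}m(x)<\infty$. For $U\subseteq X$ put $$\mathrm{cap}_m(U)=\inf\Big\{\sum_{x\in X}m(x)|f(x)|^2+Q(f)\ \Big|\ f\in\mathfrak D(G),\ \sum_{x\in X}m(x)|f(x)|^2<\infty,\ f\ge1\text{ on }U\Big\}$$ (with $\inf\emptyset=\infty$).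 Let $\sigma$ be a metric on $X$ that induces the discrete topology, let $\overline X^\sigma$ be the completion of $(X,\sigma)$ and $\partial_\sigma X=\overline X^\sigma\setminus X$. For $A\subseteq\overline X^\sigma$ put $\mathrm{cap}_m(A)=\inf\{\mathrm{cap}_m(O\cap X)\mid O\subseteq\overline X^\sigma\text{ open},\ A\subseteq O\}$. The metric $\sigma$ is intrinsic with respect to $m$ if $\frac12\sum_{y\in X}b(x,y)\sigma(x,y)^2\le m(x)$ for all $x\in X$. **Theorem.** Let $G=(X,b)$ be a connected graph, $m$ a finite measure on $X$, and $\sigma$ a metric on $X$ that induces the discrete topology and is intrinsic with respect to $m$. Suppose that $\mathrm{cap}_m(\partial_\sigma X)>0$, and let $$S=\{x\in\partial_\sigma X\mid \mathrm{cap}_m(U\cap\partial_\sigma X)>0\text{ for all open }U\subseteq\overline X^\sigma\text{ with }x\in U\}.$$ Then $\dim(\mathfrak D(G)\cap\mathfrak H(G))\ge|S|$, where $\dim$ is the dimension as a real vector space and the inequality is one between cardinal numbers. In particular, if $|S|\ge2$, then there is a non-constant harmonic function of finite energy on $G$. -/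

import Mathlib

open scoped NNReal ENNReal

/-- A weighted graph on the vertex set `X`: a symmetric edge weight `b : X × X → [0, ∞)` that
vanishes on the diagonal and has finite weighted vertex degrees. -/
structure WeightedGraph (X : Type*) where
  b : X → X → ℝ≥0
  symm : ∀ x y, b x y = b y x
  diag : ∀ x, b x x = 0
  summable : ∀ x, Summable (b x)

namespace WeightedGraph

variable {X : Type*} (G : WeightedGraph X)

/-- The weighted vertex degree. -/
noncomputable def deg (x : X) : ℝ := ∑' y, (G.b x y : ℝ)

/-- Two vertices are joined by an edge if the edge weight is positive. -/
def Adj (x y : X) : Prop := 0 < G.b x y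

/-- Any two vertices are joined by a finite path. -/
def IsConnected : Prop := ∀ x y, Relation.ReflTransGen G.Adj x y

/-- The Dirichlet energy `Q(f) = 1/2 ∑ b(x,y) |f(x) - f(y)|²`, with values in `[0, ∞]`. -/
noncomputable def energy (f : X → ℝ) : ℝ≥0∞ :=
  (1 / 2) * ∑' x, ∑' y, (G.b x y : ℝ≥0∞) * ENNReal.ofReal (|f x - f y| ^ 2)

theorem energy_zero : G.energy 0 = 0 := by
  simp [energy]

theorem energy_smul (c : ℝ) (f : X → ℝ) :
    G.energy (c • f) = ENNReal.ofReal (c ^ 2) * G.energy f := by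
  have h : ∀ x y, (G.b x y : ℝ≥0∞) * ENNReal.ofReal (|(c • f) x - (c • f) y| ^ 2)
      = ENNReal.ofReal (c ^ 2) * ((G.b x y : ℝ≥0∞) * ENNReal.ofReal (|f x - f y| ^ 2)) := by
    intro x y
    rw [mul_left_comm, ← ENNReal.ofReal_mul (sq_nonneg c)]
    congr 2
    simp only [Pi.smul_apply, smul_eq_mul, sq_abs]
    ring
  simp only [energy, h, ENNReal.tsum_mul_left]
  rw [mul_left_comm]

theorem energy_add_le (f g : X → ℝ) :
    G.energy (f + g) ≤ 2 * G.energy f + 2 * G.energy g := by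
  have h : ∀ x y, (G.b x y : ℝ≥0∞) * ENNReal.ofReal (|(f + g) x - (f + g) y| ^ 2)
      ≤ 2 * ((G.b x y : ℝ≥0∞) * ENNReal.ofReal (|f x - f y| ^ 2))
        + 2 * ((G.b x y : ℝ≥0∞) * ENNReal.ofReal (|g x - g y| ^ 2)) := by
    intro x y
    have h1 : ENNReal.ofReal (|(f + g) x - (f + g) y| ^ 2)
        ≤ 2 * ENNReal.ofReal (|f x - f y| ^ 2) + 2 * ENNReal.ofReal (|g x - g y| ^ 2) := by
      have h2 : (2 : ℝ≥0∞) = ENNReal.ofReal 2 := by simp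
      rw [h2, ← ENNReal.ofReal_mul (by norm_num), ← ENNReal.ofReal_mul (by norm_num),
        ← ENNReal.ofReal_add (by positivity) (by positivity)]
      apply ENNReal.ofReal_le_ofReal
      simp only [Pi.add_apply, sq_abs]
      nlinarith [sq_nonneg ((f x - f y) - (g x - g y))]
    calc _ ≤ (G.b x y : ℝ≥0∞) * _ := mul_le_mul_right h1 _
      _ = _ := by ring
  calc G.energy (f + g)
      ≤ (1 / 2) * ∑' x, ∑' y, (2 * ((G.b x y : ℝ≥0∞) * ENNReal.ofReal (|f x - f y| ^ 2))
        + 2 * ((G.b x y : ℝ≥0∞) * ENNReal.ofReal (|g x - g y| ^ 2))) :=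
        mul_le_mul_right (ENNReal.tsum_le_tsum fun x => ENNReal.tsum_le_tsum fun y => h x y) _
    _ = _ := by
        simp only [ENNReal.tsum_add, ENNReal.tsum_mul_left, energy]
        ring

/-- The space `𝔇(G)` of functions of finite energy. -/
def finiteEnergy : Submodule ℝ (X → ℝ) where
  carrier := {f | G.energy f < ∞}
  zero_mem' := by simp [energy_zero]
  add_mem' := by
    intro f g hf hg
    exact (G.energy_add_le f g).trans_lt
      (ENNReal.add_lt_top.2 ⟨ENNReal.mul_lt_top (by simp) hf, ENNReal.mul_lt_top (by simp) hg⟩)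
  smul_mem' := by
    intro c f hf
    simp only [Set.mem_ofPred_eq, energy_smul]
    exact ENNReal.mul_lt_top ENNReal.ofReal_lt_top hf

/-- Superharmonic functions. For real series, `Summable` is absolute convergence. -/
def IsSuperharmonic (f : X → ℝ) : Prop :=
  ∀ x, Summable (fun y => (G.b x y : ℝ) * f y) ∧
    (1 / G.deg x) * ∑' y, (G.b x y : ℝ) * f y ≤ f x

/-- Harmonic functions: `f` and `-f` are superharmonic. -/
def IsHarmonic (f : X → ℝ) : Prop := G.IsSuperharmonic f ∧ G.IsSuperharmonic (-f)

theorem isHarmonic_iff (f : X → ℝ) : G.IsHarmonic f ↔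
    ∀ x, Summable (fun y => (G.b x y : ℝ) * f y) ∧
      f x = (1 / G.deg x) * ∑' y, (G.b x y : ℝ) * f y := by
  constructor
  · rintro ⟨h1, h2⟩ x
    have h3 := (h2 x).2
    simp only [Pi.neg_apply, mul_neg, tsum_neg] at h3
    exact ⟨(h1 x).1, le_antisymm (by linarith) (h1 x).2⟩
  · intro h
    refine ⟨fun x => ⟨(h x).1, (h x).2.ge⟩, fun x => ⟨?_, ?_⟩⟩
    · simpa using (h x).1.neg
    · simp only [Pi.neg_apply, mul_neg, tsum_neg]
      exact neg_le_neg (h x).2.le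

/-- The space `ℌ(G)` of (real-valued) harmonic functions. -/
def harmonic : Submodule ℝ (X → ℝ) where
  carrier := {f | G.IsHarmonic f}
  zero_mem' := by
    simp only [Set.mem_ofPred_eq, isHarmonic_iff]
    intro x
    simp [summable_zero]
  add_mem' := by
    intro f g hf hg
    simp only [Set.mem_ofPred_eq, isHarmonic_iff] at hf hg ⊢
    intro x
    simp only [Pi.add_apply, mul_add]
    refine ⟨(hf x).1.add (hg x).1, ?_⟩
    rw [(hf x).1.tsum_add (hg x).1, mul_add, ← (hf x).2, ← (hg x).2]
  smul_mem' := by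
    intro c f hf
    simp only [Set.mem_ofPred_eq, isHarmonic_iff] at hf ⊢
    intro x
    simp only [Pi.smul_apply, smul_eq_mul, mul_left_comm _ c]
    refine ⟨(hf x).1.mul_left c, ?_⟩
    rw [tsum_mul_left, mul_left_comm, ← (hf x).2]

/-- The squared norm of `ℓ²(X,m)`, with values in `[0, ∞]`. -/
noncomputable def l2NormSq (m : X → ℝ≥0) (f : X → ℝ) : ℝ≥0∞ :=
  ∑' x, (m x : ℝ≥0∞) * ENNReal.ofReal (|f x| ^ 2)

/-- The first-order Sobolev space `H¹(G,m) = ℓ²(X,m) ∩ 𝔇(G)`. -/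
def sobolev (m : X → ℝ≥0) : Set (X → ℝ) := {f | l2NormSq m f < ∞ ∧ f ∈ G.finiteEnergy}

/-- The capacity of a set of vertices (the infimum over the empty set is `∞`). -/
noncomputable def vertexCap (m : X → ℝ≥0) (U : Set X) : ℝ≥0∞ :=
  ⨅ f ∈ {f | f ∈ G.sobolev m ∧ ∀ x ∈ U, 1 ≤ f x}, (l2NormSq m f + G.energy f)

/-- The metric of `X` is intrinsic with respect to `m`. -/
def IsIntrinsic [MetricSpace X] (m : X → ℝ≥0) : Prop :=
  ∀ x, (1 / 2) * ∑' y, (G.b x y : ℝ≥0∞) * ENNReal.ofReal (dist x y ^ 2) ≤ (m x : ℝ≥0∞)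

/-- The capacity of a subset of the metric completion of `X`. -/
noncomputable def cap [MetricSpace X] (m : X → ℝ≥0) (A : Set (UniformSpace.Completion X)) :
    ℝ≥0∞ :=
  ⨅ O ∈ {O : Set (UniformSpace.Completion X) | IsOpen O ∧ A ⊆ O},
    G.vertexCap m ((fun x : X => (x : UniformSpace.Completion X)) ⁻¹' O)

end WeightedGraph

/-- The boundary of a metric space: the points of the completion that are not in the space. -/
def metricBoundary (X : Type*) [MetricSpace X] : Set (UniformSpace.Completion X) :=
  (Set.range (fun x : X => (x : UniformSpace.Completion X)))ᶜ

/-- The support of the capacity on the boundary. -/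
def WeightedGraph.capSupport {X : Type*} (G : WeightedGraph X) [MetricSpace X] (m : X → ℝ≥0) :
    Set (UniformSpace.Completion X) :=
  {x | x ∈ metricBoundary X ∧
    ∀ U : Set (UniformSpace.Completion X), IsOpen U → x ∈ U → 0 < G.cap m (U ∩ metricBoundary X)}

/-! Let D₀ (`finiteEnergyZero`) be the closure of the finitely supported functions, pointwise and in
energy. A function in D₀ that is constant near a point of S is zero there
(`eq_zero_of_mem_finiteEnergyZero`): otherwise its differences from finitely supported approximants,
rescaled and truncated, are test functions showing that a piece of the boundary has capacity zero.
Finitely many vertices can be deleted from a neighbourhood without losing boundary points.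

If S is nonempty, this gives 1 ∉ D₀, a form of transience, so each function of finite energy is a
harmonic one plus an element of D₀ (`exists_harmonic_sub_mem_finiteEnergyZero`). Since the metric is
intrinsic and the measure finite, bounded combinations of disjoint Lipschitz bumps around points of
S have finite energy. If a linear combination of their harmonic parts vanishes, the same combination
of the bump sums lies in D₀, so its constant values near the chosen points vanish. Linearly
independent bounded coefficient families thus give linearly independent harmonic functions.

It remains to find |S| such families. For finite S, take indicators of its points. For infinite S,
take a sequence of separated points and the geometric sequences tⁿ with |S| different t in (0,1).
These suffice because the completion of a countable space has at most continuum many points, and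
they are independent by Dedekind's theorem on characters. -/

open Filter Topology

namespace WeightedGraph

/-! ### Energy, capacity and the closure of the finitely supported functions -/

section Energy

variable {X : Type*} (G : WeightedGraph X)

theorem energy_mono {f g : X → ℝ} (h : ∀ x y, |f x - f y| ≤ |g x - g y|) :
    G.energy f ≤ G.energy g := by
  unfold energy
  refine mul_le_mul_right (ENNReal.tsum_le_tsum fun x => ENNReal.tsum_le_tsum fun y => ?_) _
  have := h x y
  gcongr

theorem energy_comp_le {φ : ℝ → ℝ} (hφ : LipschitzWith 1 φ) (f : X → ℝ) :
    G.energy (fun x => φ (f x)) ≤ G.energy f :=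
  G.energy_mono fun x y => by
    simpa [Real.dist_eq] using hφ.dist_le_mul (f x) (f y)

theorem energy_const (c : ℝ) : G.energy (fun _ => c) = 0 := by
  simp [energy]

/-- With respect to an intrinsic metric of a finite measure, Lipschitz functions have finite
energy. -/
theorem IsIntrinsic.mem_finiteEnergy [MetricSpace X] {m : X → ℝ≥0} (hσ : G.IsIntrinsic m)
    (hm : Summable m) {f : X → ℝ} {C : ℝ} (hf : ∀ x y, |f x - f y| ≤ C * dist x y) :
    f ∈ G.finiteEnergy := by
  have h1 : ∀ x y, (G.b x y : ℝ≥0∞) * ENNReal.ofReal (|f x - f y| ^ 2) ≤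
      ENNReal.ofReal (C ^ 2) * ((G.b x y : ℝ≥0∞) * ENNReal.ofReal (dist x y ^ 2)) := by
    intro x y
    rw [mul_left_comm, ← ENNReal.ofReal_mul (sq_nonneg C), ← mul_pow]
    gcongr
    exact hf x y
  have h2 : G.energy f ≤ ENNReal.ofReal (C ^ 2) * ∑' x, (m x : ℝ≥0∞) := by
    calc G.energy f ≤ (1 / 2) * ∑' x, ∑' y, ENNReal.ofReal (C ^ 2) *
          ((G.b x y : ℝ≥0∞) * ENNReal.ofReal (dist x y ^ 2)) := by
          exact mul_le_mul_right
            (ENNReal.tsum_le_tsum fun x => ENNReal.tsum_le_tsum fun y => h1 x y) _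
      _ = ENNReal.ofReal (C ^ 2) * ∑' x, (1 / 2) *
          ∑' y, (G.b x y : ℝ≥0∞) * ENNReal.ofReal (dist x y ^ 2) := by
          simp only [ENNReal.tsum_mul_left]
          ring
      _ ≤ _ := by
          gcongr with x
          exact hσ x
  exact h2.trans_lt (ENNReal.mul_lt_top ENNReal.ofReal_lt_top
    (ENNReal.tsum_coe_ne_top_iff_summable.2 hm).lt_top)

/-- The functions of finite energy that are limits, pointwise and in energy, of finitely supported
functions. -/
def finiteEnergyZero : Submodule ℝ (X → ℝ) where
  carrier := {f | ∃ φ : ℕ → X → ℝ, (∀ n, (Function.support (φ n)).Finite) ∧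
    Tendsto (fun n => G.energy (f - φ n)) atTop (𝓝 0) ∧
    ∀ x, Tendsto (fun n => φ n x) atTop (𝓝 (f x))}
  zero_mem' := ⟨fun _ => 0, by simp, by simp [energy_zero], by simp⟩
  add_mem' := by
    rintro f g ⟨φ, h1, h2, h3⟩ ⟨ψ, k1, k2, k3⟩
    refine ⟨fun n => φ n + ψ n, fun n => ((h1 n).union (k1 n)).subset
      (Function.support_add _ _), ?_, fun x => (h3 x).add (k3 x)⟩
    have h := (ENNReal.Tendsto.const_mul h2 (Or.inr (by simp : (2 : ℝ≥0∞) ≠ ∞))).add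
      (ENNReal.Tendsto.const_mul k2 (Or.inr (by simp : (2 : ℝ≥0∞) ≠ ∞)))
    simp only [mul_zero, add_zero] at h
    refine tendsto_of_tendsto_of_tendsto_of_le_of_le tendsto_const_nhds h
      (fun _ => zero_le) fun n => ?_
    have := G.energy_add_le (f - φ n) (g - ψ n)
    rwa [sub_add_sub_comm] at this
  smul_mem' := by
    rintro c f ⟨φ, h1, h2, h3⟩
    refine ⟨fun n => c • φ n, fun n => (h1 n).subset (Function.support_const_smul_subset _ _),
      ?_, fun x => (h3 x).const_mul c⟩
    have h := ENNReal.Tendsto.const_mul h2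
      (Or.inr (ENNReal.ofReal_ne_top : ENNReal.ofReal (c ^ 2) ≠ ∞))
    simpa only [← smul_sub, energy_smul, mul_zero] using h

theorem mem_finiteEnergyZero_of_support_finite {f : X → ℝ} (hf : (Function.support f).Finite) :
    f ∈ G.finiteEnergyZero :=
  ⟨fun _ => f, fun _ => hf, by simp [energy_zero], fun _ => tendsto_const_nhds⟩

/-- Dominated convergence, with the finite measure `m` as majorant. -/
theorem tendsto_l2NormSq_zero {m : X → ℝ≥0} (hm : Summable m) {v : ℕ → X → ℝ}
    (hb : ∀ n x, |v n x| ≤ 1) (hv : ∀ x, Tendsto (fun n => v n x) atTop (𝓝 0)) :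
    Tendsto (fun n => l2NormSq m (v n)) atTop (𝓝 0) := by
  have hm' : Summable fun x => (m x : ℝ) := NNReal.summable_coe.2 hm
  have hle : ∀ n x, (m x : ℝ) * |v n x| ^ 2 ≤ m x := fun n x =>
    mul_le_of_le_one_right (m x).2 (pow_le_one₀ (abs_nonneg _) (hb n x))
  have h1 : ∀ n, l2NormSq m (v n) = ENNReal.ofReal (∑' x, (m x : ℝ) * |v n x| ^ 2) := by
    intro n
    rw [ENNReal.ofReal_tsum_of_nonneg (fun x => by positivity)
      (Summable.of_nonneg_of_le (fun x => by positivity) (hle n) hm')]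
    refine tsum_congr fun x => ?_
    rw [ENNReal.ofReal_mul NNReal.zero_le_coe, ENNReal.ofReal_coe_nnreal]
  have h2 : Tendsto (fun n => ∑' x, (m x : ℝ) * |v n x| ^ 2) atTop (𝓝 (∑' _ : X, (0 : ℝ))) := by
    refine tendsto_tsum_of_dominated_convergence hm' (fun x => ?_)
      (Eventually.of_forall fun n x => ?_)
    · simpa using ((hv x).abs.pow 2).const_mul (m x : ℝ)
    · rw [Real.norm_of_nonneg (by positivity)]
      exact hle n x
  simp only [h1]
  simpa using ENNReal.tendsto_ofReal h2

theorem isOpen_diff_image_finite {Y : Type*} [TopologicalSpace Y] [T1Space Y] {U : Set Y}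
    (hU : IsOpen U) {F : Set X} (hF : F.Finite) (ι : X → Y) : IsOpen (U \ ι '' F) :=
  hU.sdiff (hF.image ι).isClosed

theorem vertexCap_le {m : X → ℝ≥0} {A : Set X} {f : X → ℝ} (h1 : l2NormSq m f < ∞)
    (h2 : G.energy f < ∞) (h3 : ∀ x ∈ A, 1 ≤ f x) :
    G.vertexCap m A ≤ l2NormSq m f + G.energy f :=
  iInf₂_le (f := fun f (_ : f ∈ {f | f ∈ G.sobolev m ∧ ∀ x ∈ A, 1 ≤ f x}) =>
    l2NormSq m f + G.energy f) f ⟨⟨h1, h2⟩, h3⟩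

theorem cap_le_vertexCap [MetricSpace X] {m : X → ℝ≥0} {A O : Set (UniformSpace.Completion X)}
    (hO : IsOpen O) (h : A ⊆ O) :
    G.cap m A ≤ G.vertexCap m ((fun x : X => (x : UniformSpace.Completion X)) ⁻¹' O) :=
  iInf₂_le (f := fun O (_ : O ∈ {O : Set (UniformSpace.Completion X) | IsOpen O ∧ A ⊆ O}) =>
    G.vertexCap m ((fun x : X => (x : UniformSpace.Completion X)) ⁻¹' O)) O ⟨hO, h⟩

/-- If a function in the closure of the finitely supported functions is equal to a constant near a
point in the support of the capacity of the boundary, then that constant vanishes. -/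
theorem eq_zero_of_mem_finiteEnergyZero [MetricSpace X] {m : X → ℝ≥0} (hm : Summable m)
    {f : X → ℝ} (hf : f ∈ G.finiteEnergyZero) {p : UniformSpace.Completion X}
    (hp : p ∈ G.capSupport m) {U : Set (UniformSpace.Completion X)} (hU : IsOpen U) (hpU : p ∈ U)
    {s : ℝ} (hs : ∀ x : X, (x : UniformSpace.Completion X) ∈ U → f x = s) : s = 0 := by
  by_contra hs0
  obtain ⟨φ, h1, h2, h3⟩ := hf
  -- Truncation to [0,1] does not increase energy, supplies the bound needed for dominated
  -- convergence, and preserves the value 1.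
  let κ : ℝ → ℝ := fun t => max 0 (min 1 t)
  have hκ : LipschitzWith 1 κ := (LipschitzWith.id.const_min 1).const_max 0
  have hκ0 : κ 0 = 0 := by simp [κ]
  let v : ℕ → X → ℝ := fun n x => κ ((s⁻¹ • (f - φ n)) x)
  have hE : Tendsto (fun n => G.energy (v n)) atTop (𝓝 0) := by
    have h := ENNReal.Tendsto.const_mul h2
      (Or.inr (ENNReal.ofReal_ne_top : ENNReal.ofReal (s⁻¹ ^ 2) ≠ ∞))
    simp only [← energy_smul, mul_zero] at h
    exact tendsto_of_tendsto_of_tendsto_of_le_of_le tendsto_const_nhds h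
      (fun _ => zero_le) fun n => G.energy_comp_le hκ _
  have hL : Tendsto (fun n => l2NormSq m (v n)) atTop (𝓝 0) := by
    refine tendsto_l2NormSq_zero hm (fun n x => ?_) fun x => ?_
    · rw [abs_of_nonneg (le_max_left _ _)]
      exact max_le zero_le_one (min_le_left _ _)
    · have h : Tendsto (fun n => s⁻¹ * (f x - φ n x)) atTop (𝓝 0) := by
        simpa using ((tendsto_const_nhds (x := f x)).sub (h3 x)).const_mul s⁻¹
      have := (hκ.continuous.tendsto 0).comp h
      rwa [hκ0] at this
  have hsum := hL.add hE
  rw [add_zero] at hsum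
  have hle : ∀ᶠ n in atTop, G.cap m (U ∩ metricBoundary X) ≤ l2NormSq m (v n) + G.energy (v n) := by
    filter_upwards [hL.eventually (gt_mem_nhds zero_lt_one),
      hE.eventually (gt_mem_nhds zero_lt_one)] with n hn1 hn2
    -- Off the finite support of `φ n`, the test function `v n` is 1 on the vertices in `U`.
    -- Deleting that support removes only points of `X`, so the boundary piece stays covered.
    have hsub : U ∩ metricBoundary X ⊆ U \ (fun x : X => (x : UniformSpace.Completion X)) ''
        Function.support (φ n) := by
      rintro q ⟨hq, hqb⟩
      exact ⟨hq, fun ⟨x, _, hx⟩ => hqb ⟨x, hx⟩⟩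
    refine (G.cap_le_vertexCap (isOpen_diff_image_finite hU (h1 n) _) hsub).trans
      (G.vertexCap_le (hn1.trans (by simp)) (hn2.trans (by simp)) ?_)
    rintro x ⟨hxU, hx⟩
    have hx0 : φ n x = 0 := by
      by_contra h
      exact hx ⟨x, h, rfl⟩
    simp [v, κ, hx0, hs x hxU, hs0]
  have := ge_of_tendsto hsum hle
  exact (hp.2 U hU hpU).ne' (le_antisymm this zero_le)

end Energy

end WeightedGraph

namespace WeightedGraph

/-! ### Royden decomposition by orthogonal projection of gradients -/

section Royden

variable {X : Type*} (G : WeightedGraph X)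

/-- The weighted gradient of a function, a function on pairs of vertices. -/
noncomputable def gradFun (f : X → ℝ) (p : X × X) : ℝ :=
  √(G.b p.1 p.2) * (f p.1 - f p.2)

theorem gradFun_sq (f : X → ℝ) (p : X × X) :
    G.gradFun f p ^ 2 = G.b p.1 p.2 * (f p.1 - f p.2) ^ 2 := by
  rw [gradFun, mul_pow, Real.sq_sqrt NNReal.zero_le_coe]

theorem energy_eq_tsum_gradFun (f : X → ℝ) :
    G.energy f = (1 / 2) * ∑' p, ENNReal.ofReal (G.gradFun f p ^ 2) := by
  rw [ENNReal.tsum_prod', energy]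
  simp only [gradFun_sq, ENNReal.ofReal_mul NNReal.zero_le_coe, ENNReal.ofReal_coe_nnreal, sq_abs]

theorem summable_gradFun_sq_iff (f : X → ℝ) :
    (Summable fun p => G.gradFun f p ^ 2) ↔ f ∈ G.finiteEnergy := by
  change _ ↔ G.energy f < ∞
  rw [energy_eq_tsum_gradFun]
  constructor
  · intro h
    exact ENNReal.mul_lt_top (by simp) h.tsum_ofReal_lt_top
  · intro h
    have h1 : ∑' p, ENNReal.ofReal (G.gradFun f p ^ 2) ≠ ∞ := by
      intro h2
      rw [h2] at h
      simp at h
    simpa [ENNReal.toReal_ofReal (sq_nonneg _)] using ENNReal.summable_toReal h1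

theorem memℓp_gradFun_iff (f : X → ℝ) :
    Memℓp (G.gradFun f) 2 ↔ f ∈ G.finiteEnergy := by
  rw [← summable_gradFun_sq_iff, memℓp_gen_iff (by simp)]
  simp

/-- The gradient of a function of finite energy, as a square-summable function. -/
noncomputable def grad : G.finiteEnergy →ₗ[ℝ] lp (fun _ : X × X => ℝ) 2 where
  toFun f := ⟨G.gradFun f, (G.memℓp_gradFun_iff f).2 f.2⟩
  map_add' f g := by
    ext p
    change G.gradFun (f.1 + g.1) p = G.gradFun f.1 p + G.gradFun g.1 p
    simp only [gradFun, Pi.add_apply]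
    ring
  map_smul' c f := by
    ext p
    simp [gradFun]
    ring

theorem grad_apply (f : G.finiteEnergy) (p : X × X) : G.grad f p = G.gradFun f p := rfl

theorem energy_eq_norm_grad (f : G.finiteEnergy) :
    G.energy f = (1 / 2) * ENNReal.ofReal (‖G.grad f‖ ^ 2) := by
  have h := lp.norm_rpow_eq_tsum (p := 2) (by simp) (G.grad f)
  simp only [ENNReal.toReal_ofNat, Real.rpow_ofNat, Real.norm_eq_abs, sq_abs, grad_apply] at h
  rw [h, ENNReal.ofReal_tsum_of_nonneg (fun _ => sq_nonneg _)
    ((G.summable_gradFun_sq_iff f).2 f.2), energy_eq_tsum_gradFun]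

theorem single_mem_finiteEnergy [DecidableEq X] (x : X) :
    (Pi.single x 1 : X → ℝ) ∈ G.finiteEnergy := by
  have hb : ∑' y, (G.b x y : ℝ≥0∞) < ∞ :=
    (ENNReal.tsum_coe_ne_top_iff_summable.2 (G.summable x)).lt_top
  have h1 : ∀ u v, (G.b u v : ℝ≥0∞) *
      ENNReal.ofReal (|(Pi.single x 1 : X → ℝ) u - (Pi.single x 1 : X → ℝ) v| ^ 2) ≤
      (if u = x then (G.b x v : ℝ≥0∞) else 0) + (if v = x then (G.b x u : ℝ≥0∞) else 0) := by
    intro u v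
    by_cases hu : u = x <;> by_cases hv : v = x <;> simp [hu, hv, G.symm]
  have h2 : ∑' u, ∑' v, ((if u = x then (G.b x v : ℝ≥0∞) else 0) +
      (if v = x then (G.b x u : ℝ≥0∞) else 0)) < ∞ := by
    simp only [ENNReal.tsum_add]
    rw [ENNReal.tsum_comm]
    simp [tsum_ite_eq, hb]
  exact ENNReal.mul_lt_top (by simp)
    ((ENNReal.tsum_le_tsum fun u => ENNReal.tsum_le_tsum fun v => h1 u v).trans_lt h2)

variable {G}

/-- Uses |t| ≤ 1 + t², together with finite degree and finite energy. -/
theorem summable_mul_sub {f : X → ℝ} (hf : f ∈ G.finiteEnergy) (x : X) :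
    Summable fun y => (G.b x y : ℝ) * (f x - f y) := by
  have h1 : Summable fun y => (G.b x y : ℝ) * (f x - f y) ^ 2 := by
    have := ((G.summable_gradFun_sq_iff f).2 hf).comp_injective (Prod.mk_right_injective x)
    simpa [Function.comp_def, gradFun_sq] using this
  have h2 : Summable fun y => (G.b x y : ℝ) := NNReal.summable_coe.2 (G.summable x)
  refine Summable.of_norm_bounded (h2.add h1) fun y => ?_
  rw [Real.norm_eq_abs, abs_mul, NNReal.abs_eq, ← mul_one_add]
  gcongr
  rw [← sq_abs (f x - f y)]
  nlinarith [sq_nonneg (|f x - f y| - 1), abs_nonneg (f x - f y)]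

/-- Green's formula against a point mass. The factor 2 arises because each edge at `x` occurs in
both orientations. Orthogonality to all point masses is therefore harmonicity. -/
theorem inner_grad_single [DecidableEq X] (f : G.finiteEnergy) (x : X) :
    inner ℝ (G.grad ⟨Pi.single x 1, G.single_mem_finiteEnergy x⟩) (G.grad f) =
      2 * ∑' y, (G.b x y : ℝ) * (f.1 x - f.1 y) := by
  have hs := (summable_mul_sub f.2 x).hasSum
  have h1 : HasSum (fun p : X × X => if p.1 = x then (G.b x p.2 : ℝ) * (f.1 x - f.1 p.2) else 0)
      (∑' y, (G.b x y : ℝ) * (f.1 x - f.1 y)) := by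
    refine ((Prod.mk_right_injective x).hasSum_iff ?_).1 (by simpa [Function.comp_def] using hs)
    rintro ⟨u, v⟩ huv
    refine if_neg ?_
    rintro rfl
    exact huv ⟨v, rfl⟩
  have h2 : HasSum (fun p : X × X => if p.2 = x then (G.b x p.1 : ℝ) * (f.1 x - f.1 p.1) else 0)
      (∑' y, (G.b x y : ℝ) * (f.1 x - f.1 y)) := by
    refine ((Prod.mk_left_injective x).hasSum_iff ?_).1 (by simpa [Function.comp_def] using hs)
    rintro ⟨u, v⟩ huv
    refine if_neg ?_
    rintro rfl
    exact huv ⟨u, rfl⟩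
  rw [two_mul, ← (h1.add h2).tsum_eq, lp.inner_eq_tsum]
  refine tsum_congr fun ⟨u, v⟩ => ?_
  have hr : √(G.b u v : ℝ) * √(G.b u v : ℝ) = G.b u v := Real.mul_self_sqrt (G.b u v).2
  simp only [grad_apply, gradFun, RCLike.inner_apply, conj_trivial]
  rw [mul_mul_mul_comm, hr]
  by_cases hu : u = x <;> by_cases hv : v = x
  · simp [hu, hv]
  · subst hu; simp [hv]
  · subst hv; simp [hu, G.symm]
  · simp [hu, hv]

theorem deg_pos [Nontrivial X] (hconn : G.IsConnected) (x : X) : 0 < G.deg x := by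
  obtain ⟨y, hy⟩ := exists_ne x
  rcases (hconn x y).cases_head with h | ⟨z, hz, _⟩
  · exact absurd h.symm hy
  · exact (NNReal.summable_coe.2 (G.summable x)).tsum_pos (fun _ => NNReal.zero_le_coe) z
      (by exact_mod_cast hz)

theorem isHarmonic_of_tsum_eq_zero [Nontrivial X] (hconn : G.IsConnected) {f : X → ℝ}
    (hf : f ∈ G.finiteEnergy) (h : ∀ x, ∑' y, (G.b x y : ℝ) * (f x - f y) = 0) :
    G.IsHarmonic f := by
  rw [isHarmonic_iff]
  intro x
  have h1 := summable_mul_sub hf x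
  have h2 : Summable fun y => (G.b x y : ℝ) * f x :=
    (NNReal.summable_coe.2 (G.summable x)).mul_right _
  have h3 : (fun y => (G.b x y : ℝ) * f y) =
      fun y => (G.b x y : ℝ) * f x - (G.b x y : ℝ) * (f x - f y) := by
    ext y; ring
  rw [h3]
  refine ⟨h2.sub h1, ?_⟩
  rw [h2.tsum_sub h1, h x, tsum_mul_right, sub_zero]
  change f x = 1 / G.deg x * (G.deg x * f x)
  field_simp [(deg_pos hconn x).ne']

variable (G) in
/-- The finitely supported functions, as a subspace of the functions of finite energy. -/
def finiteSupport : Submodule ℝ G.finiteEnergy where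
  carrier := {f | (Function.support f.1).Finite}
  zero_mem' := by simp
  add_mem' := fun {f g} hf hg => (hf.union hg).subset (Function.support_add f.1 g.1)
  smul_mem' := fun c f hf => hf.subset (Function.support_const_smul_subset c f.1)

/-- Convergence of the gradients implies convergence of the differences of the values. -/
theorem exists_tendsto_sub (hconn : G.IsConnected) {φ : ℕ → G.finiteEnergy}
    {P : lp (fun _ : X × X => ℝ) 2} (hφ : Tendsto (fun n => G.grad (φ n)) atTop (𝓝 P)) (o x : X) :
    ∃ a, Tendsto (fun n => (φ n).1 x - (φ n).1 o) atTop (𝓝 a) := by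
  -- Along a path, each increment is a coordinate of the gradient divided by the positive number √b.
  induction hconn o x with
  | refl => exact ⟨0, by simp⟩
  | @tail y z _ hyz ih =>
    obtain ⟨a, ha⟩ := ih
    have h1 : Tendsto (fun n => G.grad (φ n) (z, y)) atTop (𝓝 (P (z, y))) :=
      ((lp.evalCLM ℝ (fun _ : X × X => ℝ) 2 (z, y)).continuous.tendsto P).comp hφ
    have h2 : √(G.b z y : ℝ) ≠ 0 := by
      rw [G.symm]
      exact (Real.sqrt_pos.2 (by exact_mod_cast hyz)).ne'
    refine ⟨(√(G.b z y : ℝ))⁻¹ * P (z, y) + a, ((h1.const_mul _).add ha).congr fun n => ?_⟩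
    simp only [grad_apply, gradFun]
    rw [inv_mul_cancel_left₀ h2]
    ring

/-- Increments converge by connectedness, so convergence at `o` forces pointwise convergence
everywhere, and the gradient of the pointwise limit is read off coordinatewise. -/
theorem exists_grad_eq_of_tendsto (hconn : G.IsConnected) {φ : ℕ → G.finiteEnergy}
    (hfin : ∀ n, φ n ∈ G.finiteSupport) {P : lp (fun _ : X × X => ℝ) 2}
    (hφ : Tendsto (fun n => G.grad (φ n)) atTop (𝓝 P)) {o : X} {a : ℝ}
    (ha : Tendsto (fun n => (φ n).1 o) atTop (𝓝 a)) :
    ∃ g : G.finiteEnergy, g.1 ∈ G.finiteEnergyZero ∧ G.grad g = P := by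
  choose d hd using exists_tendsto_sub hconn hφ o
  have hg : ∀ x, Tendsto (fun n => (φ n).1 x) atTop (𝓝 (d x + a)) := fun x =>
    ((hd x).add ha).congr fun n => by ring
  have hP : G.gradFun (fun x => d x + a) = P := by
    ext p
    have h1 : Tendsto (fun n => G.grad (φ n) p) atTop (𝓝 (P p)) :=
      ((lp.evalCLM ℝ (fun _ : X × X => ℝ) 2 p).continuous.tendsto P).comp hφ
    exact tendsto_nhds_unique (((hg p.1).sub (hg p.2)).const_mul _) h1
  have hmem : (fun x => d x + a) ∈ G.finiteEnergy := by
    rw [← memℓp_gradFun_iff, hP]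
    exact P.2
  have hgrad : G.grad ⟨_, hmem⟩ = P := by
    ext p
    exact congrFun hP p
  refine ⟨⟨_, hmem⟩, ⟨fun n => (φ n).1, hfin, ?_, hg⟩, hgrad⟩
  have h1 : Tendsto (fun n => (1 / 2) * ENNReal.ofReal (‖P - G.grad (φ n)‖ ^ 2)) atTop (𝓝 0) := by
    have h2 : Tendsto (fun n => ‖P - G.grad (φ n)‖ ^ 2) atTop (𝓝 0) := by
      simpa using (((tendsto_const_nhds (x := P)).sub hφ).norm.pow 2)
    simpa using ENNReal.Tendsto.const_mul (ENNReal.tendsto_ofReal h2)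
      (Or.inr (by simp : (1 / 2 : ℝ≥0∞) ≠ ∞))
  refine h1.congr fun n => ?_
  rw [← hgrad, ← map_sub, ← energy_eq_norm_grad]
  rfl

/-- Dividing `φ n` by its value at `o` sends the gradients and all increments to 0, while the value
at `o` is eventually 1. -/
theorem one_mem_finiteEnergyZero_of_tendsto (hconn : G.IsConnected) {φ : ℕ → G.finiteEnergy}
    (hfin : ∀ n, φ n ∈ G.finiteSupport) {P : lp (fun _ : X × X => ℝ) 2}
    (hφ : Tendsto (fun n => G.grad (φ n)) atTop (𝓝 P)) {o : X}
    (ha : Tendsto (fun n => |(φ n).1 o|) atTop atTop) :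
    (1 : X → ℝ) ∈ G.finiteEnergyZero := by
  have hinv : Tendsto (fun n => ((φ n).1 o)⁻¹) atTop (𝓝 0) := by
    rw [tendsto_zero_iff_abs_tendsto_zero]
    simpa [Function.comp_def, abs_inv] using tendsto_inv_atTop_zero.comp ha
  have h1mem : (1 : X → ℝ) ∈ G.finiteEnergy := by
    change G.energy (fun _ => 1) < ∞
    simp [energy_const]
  have h1grad : G.grad ⟨1, h1mem⟩ = 0 := by
    ext p
    simp [grad_apply, gradFun]
  refine ⟨fun n => (((φ n).1 o)⁻¹ • φ n).1, fun n => G.finiteSupport.smul_mem _ (hfin n),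
    ?_, fun x => ?_⟩
  · have h1 : Tendsto (fun n => (1 / 2) * ENNReal.ofReal (‖-(((φ n).1 o)⁻¹ • G.grad (φ n))‖ ^ 2))
        atTop (𝓝 0) := by
      have h2 : Tendsto (fun n => ‖-(((φ n).1 o)⁻¹ • G.grad (φ n))‖ ^ 2) atTop (𝓝 0) := by
        simpa using ((hinv.smul hφ).neg.norm.pow 2)
      simpa using ENNReal.Tendsto.const_mul (ENNReal.tendsto_ofReal h2)
        (Or.inr (by simp : (1 / 2 : ℝ≥0∞) ≠ ∞))
    refine h1.congr fun n => ?_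
    rw [← zero_sub, ← h1grad, ← map_smul, ← map_sub, ← energy_eq_norm_grad]
    rfl
  · obtain ⟨d, hd⟩ := exists_tendsto_sub hconn hφ o x
    have h1 : Tendsto (fun n => ((φ n).1 o)⁻¹ * ((φ n).1 x - (φ n).1 o) + 1) atTop (𝓝 1) := by
      simpa using (hinv.mul hd).add_const 1
    refine h1.congr' ?_
    filter_upwards [ha.eventually (eventually_gt_atTop 0)] with n hn
    have : (φ n).1 o ≠ 0 := abs_pos.1 hn
    simp only [Submodule.coe_smul, Pi.smul_apply, smul_eq_mul]
    field_simp
    ring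

/-- The Royden decomposition of a transient graph. -/
theorem exists_harmonic_sub_mem_finiteEnergyZero [Nonempty X] (hconn : G.IsConnected)
    (h1 : (1 : X → ℝ) ∉ G.finiteEnergyZero) {f : X → ℝ} (hf : f ∈ G.finiteEnergy) :
    ∃ h ∈ G.finiteEnergy ⊓ G.harmonic, f - h ∈ G.finiteEnergyZero := by
  classical
  have : Infinite X := by
    by_contra hX
    rw [not_infinite_iff_finite] at hX
    exact h1 (G.mem_finiteEnergyZero_of_support_finite (Set.toFinite _))
  let K := (G.finiteSupport.map G.grad).topologicalClosure
  have hK : IsClosed (K : Set (lp (fun _ : X × X => ℝ) 2)) :=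
    Submodule.isClosed_topologicalClosure _
  have : CompleteSpace K := hK.completeSpace_coe
  obtain ⟨P, hP, R, hR, hPR⟩ := K.exists_add_mem_mem_orthogonal (G.grad ⟨f, hf⟩)
  have hP' : P ∈ closure ((G.finiteSupport.map G.grad : Submodule ℝ _) :
      Set (lp (fun _ : X × X => ℝ) 2)) := hP
  obtain ⟨ψ, hψ, hψP⟩ := mem_closure_iff_seq_limit.1 hP'
  choose φ hφ hφψ using hψ
  obtain rfl : (fun n => G.grad (φ n)) = ψ := funext hφψ
  let o : X := Classical.arbitrary X
  -- Transience enters here: the values at `o` cannot escape to infinity, so a subsequence of them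
  -- converges and the projection `P` is a gradient.
  have hfreq : ¬ Tendsto (fun n => |(φ n).1 o|) atTop atTop := fun h =>
    h1 (one_mem_finiteEnergyZero_of_tendsto hconn hφ hψP h)
  obtain ⟨M, hM⟩ : ∃ M : ℝ, ∃ᶠ n in atTop, (φ n).1 o ∈ Metric.closedBall (0 : ℝ) M := by
    rw [tendsto_atTop] at hfreq
    push Not at hfreq
    obtain ⟨M, hM⟩ := hfreq
    refine ⟨M, hM.mono fun n hn => ?_⟩
    simpa using hn.le
  obtain ⟨a, -, k, hk, ha⟩ := tendsto_subseq_of_frequently_bounded Metric.isBounded_closedBall hM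
  obtain ⟨g, hg, hgP⟩ := exists_grad_eq_of_tendsto hconn (fun n => hφ (k n))
    (hψP.comp hk.tendsto_atTop) ha
  have hgrad : G.grad (⟨f, hf⟩ - g) = R := by
    rw [map_sub, hgP, hPR, add_sub_cancel_left]
  refine ⟨(⟨f, hf⟩ - g : G.finiteEnergy), ⟨Subtype.prop _,
    isHarmonic_of_tsum_eq_zero hconn (Subtype.prop _) fun x => ?_⟩, by simpa using hg⟩
  have hx : (⟨Pi.single x 1, G.single_mem_finiteEnergy x⟩ : G.finiteEnergy) ∈ G.finiteSupport :=
    (Set.finite_singleton x).subset Pi.support_single_subset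
  have h2 := Submodule.inner_right_of_mem_orthogonal
    (Submodule.le_topologicalClosure _ (Submodule.mem_map_of_mem hx)) hR
  rw [← hgrad, inner_grad_single] at h2
  simpa using h2

end Royden

end WeightedGraph

/-! ### Lipschitz bumps with disjoint supports -/

section Bump

variable {Y ι : Type*} [PseudoMetricSpace Y] (p : ι → Y) (r : ι → ℝ)

/-- A nonnegative `1`-Lipschitz function that is supported in the ball of radius `r i / 2` around
`p i` and equal to `r i / 4` on the ball of half that radius. -/
noncomputable def bump (i : ι) (y : Y) : ℝ := min (r i / 4) (max 0 (r i / 2 - dist y (p i)))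

/-- The combination of the bumps around the points `p i` with coefficients `c i`. -/
noncomputable def bumpSum (c : ι → ℝ) (y : Y) : ℝ := ∑ᶠ i, c i * bump p r i y

theorem abs_bump_sub_le (i : ι) (y z : Y) : |bump p r i y - bump p r i z| ≤ dist y z := by
  have h0 : LipschitzWith 1 fun y => r i / 2 - dist y (p i) :=
    LipschitzWith.of_dist_le_mul fun y z => by
      rw [NNReal.coe_one, one_mul, Real.dist_eq, sub_sub_sub_cancel_left, abs_sub_comm]
      exact abs_dist_sub_le y z (p i)
  have h : LipschitzWith 1 (bump p r i) := (h0.const_max 0).const_min (r i / 4)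
  simpa [Real.dist_eq] using h.dist_le_mul y z

variable {p r}

theorem bump_of_dist_le {i : ι} {y : Y} (h : dist y (p i) ≤ r i / 4) : bump p r i y = r i / 4 :=
  min_eq_left (le_max_of_le_right (by linarith))

theorem dist_lt_of_bump_ne_zero {i : ι} {y : Y} (hr : 0 < r i) (h : bump p r i y ≠ 0) :
    dist y (p i) < r i / 2 := by
  contrapose! h
  rw [bump, max_eq_left (by linarith), min_eq_right (by positivity)]

/-- A common point of two supports would put the centres closer than (r i + r j)/2, hence closer
than one of the radii. -/
theorem bump_eq_zero_of_ne (hr : ∀ i, 0 < r i) (hsep : ∀ i j, i ≠ j → r i ≤ dist (p i) (p j))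
    {i j : ι} (hij : i ≠ j) {y : Y} (h : bump p r i y ≠ 0) : bump p r j y = 0 := by
  by_contra hj
  have h1 := dist_lt_of_bump_ne_zero (hr i) h
  have h2 := dist_lt_of_bump_ne_zero (hr j) hj
  have h3 := hsep i j hij
  have h4 := hsep j i hij.symm
  have h5 := dist_triangle_left (p i) (p j) y
  rw [dist_comm] at h4
  linarith

theorem exists_forall_ne_bump_eq_zero [Nonempty ι] (hr : ∀ i, 0 < r i)
    (hsep : ∀ i j, i ≠ j → r i ≤ dist (p i) (p j)) (y : Y) :
    ∃ i, ∀ j, j ≠ i → bump p r j y = 0 := by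
  by_cases h : ∃ i, bump p r i y ≠ 0
  · obtain ⟨i, hi⟩ := h
    exact ⟨i, fun j hj => bump_eq_zero_of_ne hr hsep hj.symm hi⟩
  · push Not at h
    exact ⟨Classical.arbitrary ι, fun j _ => h j⟩

theorem bumpSum_eq (c : ι → ℝ) {i : ι} {y : Y} (h : ∀ j, j ≠ i → bump p r j y = 0) :
    bumpSum p r c y = c i * bump p r i y :=
  finsum_eq_single _ i fun j hj => by rw [h j hj, mul_zero]

theorem bumpSum_of_mem_ball (hr : ∀ i, 0 < r i) (hsep : ∀ i j, i ≠ j → r i ≤ dist (p i) (p j))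
    (c : ι → ℝ) {i : ι} {y : Y} (hy : y ∈ Metric.ball (p i) (r i / 4)) :
    bumpSum p r c y = c i * (r i / 4) := by
  have h := bump_of_dist_le (Metric.mem_ball.1 hy).le
  rw [bumpSum_eq c (fun j hj => bump_eq_zero_of_ne hr hsep hj.symm ?_), h]
  rw [h]
  exact (div_pos (hr i) (by norm_num)).ne'

/-- At each of `y` and `z` at most one bump is nonzero. Each of these two bumps contributes at most
`C * dist y z`, whence the factor 2. -/
theorem abs_bumpSum_sub_le [Nonempty ι] (hr : ∀ i, 0 < r i)
    (hsep : ∀ i j, i ≠ j → r i ≤ dist (p i) (p j)) {c : ι → ℝ} {C : ℝ} (hc : ∀ i, |c i| ≤ C)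
    (y z : Y) : |bumpSum p r c y - bumpSum p r c z| ≤ 2 * C * dist y z := by
  have key : ∀ i, |c i * (bump p r i y - bump p r i z)| ≤ C * dist y z := fun i => by
    rw [abs_mul]
    exact mul_le_mul (hc i) (abs_bump_sub_le p r i y z) (abs_nonneg _) ((abs_nonneg _).trans (hc i))
  obtain ⟨i, hi⟩ := exists_forall_ne_bump_eq_zero hr hsep y
  obtain ⟨j, hj⟩ := exists_forall_ne_bump_eq_zero hr hsep z
  have hi' := key i
  have hj' := key j
  rw [bumpSum_eq c hi, bumpSum_eq c hj]
  by_cases hij : i = j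
  · subst hij
    rw [← mul_sub]
    linarith [abs_nonneg (c i * (bump p r i y - bump p r i z))]
  · rw [hj i hij, sub_zero] at hi'
    rw [hi j (Ne.symm hij), zero_sub, mul_neg, abs_neg] at hj'
    linarith [abs_sub (c i * bump p r i y) (c j * bump p r j z)]

end Bump

/-! ### Counting independent harmonic functions -/

namespace WeightedGraph

variable {X : Type*} {G : WeightedGraph X} [MetricSpace X] {m : X → ℝ≥0}

/-- A linearly independent family of bounded functions on a family of separated points in the
support of the capacity bounds the dimension of the harmonic functions of finite energy. -/
theorem mk_le_rank_of_linearIndependent [Nonempty X] (hconn : G.IsConnected) (hm : Summable m)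
    (hσ : G.IsIntrinsic m) {ι : Type*} [Nonempty ι] (p : ι → G.capSupport m)
    {U : ι → Set (G.capSupport m)} (hU : ∀ i, IsOpen (U i)) (hpU : ∀ i, p i ∈ U i)
    (hdisj : Pairwise (Function.onFun Disjoint U)) {c : G.capSupport m → ι → ℝ}
    (hc : ∀ k, ∃ C, ∀ i, |c k i| ≤ C) (hli : LinearIndependent ℝ c) :
    Cardinal.mk (G.capSupport m) ≤ Module.rank ℝ ↥(G.finiteEnergy ⊓ G.harmonic) := by
  have h1 : (1 : X → ℝ) ∉ G.finiteEnergyZero := fun h =>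
    one_ne_zero (G.eq_zero_of_mem_finiteEnergyZero hm h (p (Classical.arbitrary ι)).2 isOpen_univ
      trivial (s := 1) fun _ _ => rfl)
  choose r hr hrU using fun i => Metric.isOpen_iff.1 (hU i) (p i) (hpU i)
  let q : ι → UniformSpace.Completion X := fun i => p i
  have hsep : ∀ i j, i ≠ j → r i ≤ dist (q i) (q j) := by
    intro i j hij
    by_contra! h
    exact Set.disjoint_left.1 (hdisj hij)
      (hrU i (by rw [Metric.mem_ball, dist_comm]; exact h)) (hpU j)
  let F : G.capSupport m → X → ℝ := fun k x => bumpSum q r (c k) (x : UniformSpace.Completion X)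
  have hF : ∀ k, F k ∈ G.finiteEnergy := by
    intro k
    obtain ⟨C, hC⟩ := hc k
    refine hσ.mem_finiteEnergy G hm (C := 2 * C) fun x y => ?_
    rw [← UniformSpace.Completion.dist_eq x y]
    exact abs_bumpSum_sub_le hr hsep hC _ _
  choose h hh hFh using fun k => exists_harmonic_sub_mem_finiteEnergyZero hconn h1 (hF k)
  let v : G.capSupport m → ↥(G.finiteEnergy ⊓ G.harmonic) := fun k => ⟨h k, hh k⟩
  refine LinearIndependent.cardinal_le_rank (v := v) ?_
  rw [linearIndependent_iff'] at hli ⊢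
  intro t s hs
  refine hli t s ?_
  ext i
  have hs' : ∑ k ∈ t, s k • h k = 0 := by
    simpa [v] using congrArg Subtype.val hs
  -- As the harmonic parts cancel, only the D₀ parts of the `F k` remain.
  have hmem : ∑ k ∈ t, s k • F k ∈ G.finiteEnergyZero := by
    have := G.finiteEnergyZero.sum_mem fun k (_ : k ∈ t) => G.finiteEnergyZero.smul_mem (s k) (hFh k)
    simpa [smul_sub, Finset.sum_sub_distrib, hs'] using this
  have h0 := G.eq_zero_of_mem_finiteEnergyZero hm hmem (p i).2
    (Metric.isOpen_ball (x := q i) (ε := r i / 4)) (Metric.mem_ball_self (by linarith [hr i]))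
    (s := (∑ k ∈ t, s k * c k i) * (r i / 4)) fun x hx => by
      simp only [Finset.sum_apply, Pi.smul_apply, smul_eq_mul, Finset.sum_mul, F,
        bumpSum_of_mem_ball hr hsep _ hx, mul_assoc]
  simpa [(hr i).ne'] using h0

theorem mk_completion_le_continuum [Countable X] :
    Cardinal.mk (UniformSpace.Completion X) ≤ Cardinal.continuum := by
  have h : ∀ y : UniformSpace.Completion X, ∃ u : ℕ → X,
      Tendsto (fun n => (u n : UniformSpace.Completion X)) atTop (𝓝 y) := by
    intro y
    obtain ⟨u, hu, huy⟩ := mem_closure_iff_seq_limit.1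
      (UniformSpace.Completion.denseRange_coe (α := X) y)
    choose w hw using hu
    exact ⟨w, by simpa only [hw] using huy⟩
  choose u hu using h
  have hinj : Function.Injective u := fun y z hyz =>
    tendsto_nhds_unique (hu y) (by rw [hyz]; exact hu z)
  calc Cardinal.mk (UniformSpace.Completion X)
      ≤ Cardinal.mk (ℕ → X) := Cardinal.mk_le_of_injective hinj
    _ = Cardinal.mk X ^ Cardinal.aleph0 := by simp
    _ ≤ Cardinal.aleph0 ^ Cardinal.aleph0 := Cardinal.power_le_power_right Cardinal.mk_le_aleph0
    _ = Cardinal.continuum := Cardinal.aleph0_power_aleph0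

theorem mk_capSupport_le_rank [Nonempty X] [Countable X] (hconn : G.IsConnected)
    (hm : Summable m) (hσ : G.IsIntrinsic m) :
    Cardinal.mk (G.capSupport m) ≤ Module.rank ℝ ↥(G.finiteEnergy ⊓ G.harmonic) := by
  classical
  rcases isEmpty_or_nonempty (G.capSupport m) with hE | hE
  · simp
  rcases finite_or_infinite (G.capSupport m) with hfin | hinf
  -- A finite Hausdorff space is discrete, so all points of S can be separated at once.
  · refine mk_le_rank_of_linearIndependent hconn hm hσ id (U := fun k => {k})
      (fun _ => isOpen_discrete _) (fun _ => rfl) (fun k l hkl => by simpa using hkl)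
      (c := fun k => Pi.single k 1) (fun k => ⟨1, fun i => ?_⟩)
      (Pi.linearIndependent_single_one _ ℝ)
    by_cases h : i = k <;> simp [h]
  · obtain ⟨U, hUinf, hU, hdisj⟩ := exists_seq_infinite_isOpen_pairwise_disjoint (G.capSupport m)
    choose p hp using fun n => (hUinf n).nonempty
    have hle : Cardinal.lift.{0} (Cardinal.mk (G.capSupport m)) ≤
        Cardinal.lift (Cardinal.mk (Set.Ioo (0 : ℝ) 1)) := by
      rw [Cardinal.mk_Ioo_real zero_lt_one, Cardinal.lift_continuum, Cardinal.lift_id']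
      exact (Cardinal.mk_set_le _).trans mk_completion_le_continuum
    obtain ⟨t⟩ := Cardinal.lift_mk_le'.1 hle
    -- The sequence n ↦ tⁿ is a character of the monoid ℕ that determines t. Distinct characters are
    -- linearly independent, and t in (0,1) keeps the sequence bounded.
    have hinj : Function.Injective fun k => powersHom ℝ (t k : ℝ) :=
      (powersHom ℝ).injective.comp (Subtype.val_injective.comp t.injective)
    refine mk_le_rank_of_linearIndependent hconn hm hσ p hU hp hdisj
      (c := fun k n => (t k : ℝ) ^ n) (fun k => ⟨1, fun n => ?_⟩)
      ((linearIndependent_monoidHom (Multiplicative ℕ) ℝ).comp _ hinj)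
    rw [abs_of_nonneg (pow_nonneg (t k).2.1.le n)]
    exact pow_le_one₀ (t k).2.1.le (t k).2.2.le

end WeightedGraph

theorem mainTheorem5 {X : Type*} [Nonempty X] [Countable X]
    (G : WeightedGraph X) (hconn : G.IsConnected)
    [MetricSpace X] [DiscreteTopology X]
    (m : X → ℝ≥0) (hm_pos : ∀ x, 0 < m x) (hm_fin : Summable m)
    (hσ : G.IsIntrinsic m)
    (hcap : 0 < G.cap m (metricBoundary X)) :
    Cardinal.mk (G.capSupport m) ≤ Module.rank ℝ ↥(G.finiteEnergy ⊓ G.harmonic) ∧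
    (2 ≤ Cardinal.mk (G.capSupport m) →
      ∃ h : X → ℝ, h ∈ G.finiteEnergy ∧ G.IsHarmonic h ∧ ¬ ∃ c : ℝ, ∀ x, h x = c) := by
  have hrank := WeightedGraph.mk_capSupport_le_rank hconn hm_fin hσ
  refine ⟨hrank, fun h2 => ?_⟩
  by_contra! hconst
  -- If all such harmonic functions were constant, 1 would span the space.
  have h1 : Module.rank ℝ ↥(G.finiteEnergy ⊓ G.harmonic) ≤ 1 := by
    refine (rank_submodule_le_one_iff' _).2 ⟨1, fun h hh => ?_⟩
    obtain ⟨c, hc⟩ := hconst h hh.1 hh.2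
    exact Submodule.mem_span_singleton.2 ⟨c, by ext x; simp [hc x]⟩
  exact absurd ((h2.trans hrank).trans h1) (by norm_num)
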